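/- Fix a constant $R>1$ and put $\varepsilon=(R-1)/8$ and $T=\sqrt2+2\varepsilon$. For $r>0$ let $\sigma_r$ be the uniform distribution on the sphere of radius $r$ about the origin in $\mathbb R^d$, and let $D=\tfrac12\sigma_1+\tfrac12\sigma_R$. Draw a training set $X=(x_1,\dots,x_{2N})$, $N\ge1$, of independent points, $x_1,\dots,x_N\sim\sigma_1$ and $x_{N+1},\dots,x_{2N}\sim\sigma_R$. Let $G(X)$ be the graph on $1,\dots,2N$ joining $i\ne j$ when $\|x_i-x_j\|_2\le T$, and, for $x\in\mathbb R^d$, let $G(x)$ be the graph defined in the same way on $0,1,\dots,2N$ with $x_0=x$. Let $v_1,\dots,v_{N+1}\in\mathbb R^{2N}$ be orthonormal eigenvectors of the Laplacian of $G(X)$ for its $N+1$ smallest eigenvalues (with multiplicity), and let $v_i'=(0,v_i)\in\mathbb R^{2N+1}$. Let $P_x$ be the orthogonal projection of $\mathbb R^{2N+1}$ onto the bottom-$(N+1)$ eigenspace of $G(x)$, that is, the span of all eigenvectors of the Laplacian of $G(x)$ whose eigenvalue is at most the $(N+1)$-th smallest one. Define $f:\mathbb R^d\to\mathbb R^{N+1}$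 by $f(x)_i=(P_xv_i')_0$. Then there are $c>0$ and $d_0$, depending only on $R$, such that for all $d\ge d_0$ and $N\ge1$, with $\gamma=Ne^{-cd}$, the following holds with probability at least $1-N^2e^{-cd}$ over $X$, for every choice of the $v_i$. There are points $a\ne b$ in $\mathbb R^{N+1}$ with $$\sigma_1\{x: f(x)\ne a\}\le\gamma\quad\text{and}\quad \sigma_R\{x: f(x)\ne b\}\le\gamma,$$ and $f$ is $(\varepsilon,0,\gamma)$-robust for $D$ in the $\ell_2$ metric: $$\Pr_{x\sim D}\big[\exists x'\in\mathbb R^d:\ \|x-x'\|_2\le\varepsilon\ \text{and}\ \|f(x)-f(x')\|>0\big]\le\gamma.$$ -/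

import Mathlib

open MeasureTheory

/-- The threshold graph of a finite family of points: vertices are the indices, and two distinct
indices are joined when the points are at distance at most `T`. -/
def thresholdGraph {E V : Type*} [PseudoMetricSpace E] (T : ℝ) (p : V → E) : SimpleGraph V where
  Adj i j := i ≠ j ∧ dist (p i) (p j) ≤ T
  symm := ⟨fun _ _ h => ⟨h.1.symm, by rw [dist_comm]; exact h.2⟩⟩
  loopless := ⟨fun _ h => h.1 rfl⟩

/-- The dataset `X` augmented with the new point `x`, which gets the index `none`. -/
def augment {E ι : Type*} (X : ι → E) (x : E) : Option ι → E
  | none => x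
  | some i => X i

open Classical in
/-- The (unnormalized) graph Laplacian `D - A` over the reals. -/
noncomputable def laplacian {V : Type*} [Fintype V] (G : SimpleGraph V) : Matrix V V ℝ :=
  G.lapMatrix ℝ

theorem laplacian_isHermitian {V : Type*} [Fintype V] (G : SimpleGraph V) :
    (laplacian G).IsHermitian := by
  classical
  have h := G.isSymm_lapMatrix (R := ℝ)
  unfold laplacian
  rw [Matrix.IsHermitian, Matrix.conjTranspose_eq_transpose_of_trivial]
  convert h.eq

open Classical in
/-- The Laplacian eigenvalues in increasing order, with multiplicity, numbered from `0`: the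
`k`-th smallest one is `lapEigenvalue G (k - 1)`.  Only indices below the number of vertices are meaningful. -/
noncomputable def lapEigenvalue {V : Type*} [Fintype V] (G : SimpleGraph V) (j : ℕ) : ℝ :=
  if h : j < Fintype.card V then (laplacian_isHermitian G).eigenvalues₀ (Fin.rev ⟨j, h⟩) else 0

/-- `v 0, …, v (k - 1)` are orthonormal eigenvectors of the Laplacian of `G` for its `k` smallest
eigenvalues, counted with multiplicity. -/
def IsBottomEigenvectors {V : Type*} [Fintype V] (G : SimpleGraph V) {k : ℕ}
    (v : Fin k → EuclideanSpace ℝ V) : Prop :=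
  Orthonormal ℝ v ∧
    ∀ i : Fin k, Matrix.mulVec (laplacian G) (v i).ofLp = lapEigenvalue G i • (v i).ofLp

/-- The bottom-`k` eigenspace (`k ≥ 1`): the span of all eigenvectors of the Laplacian whose
eigenvalue is at most the `k`-th smallest one. -/
noncomputable def bottomEigenspace {V : Type*} [Fintype V] (G : SimpleGraph V) (k : ℕ) :
    Submodule ℝ (EuclideanSpace ℝ V) :=
  Submodule.span ℝ {w | ∃ μ : ℝ, μ ≤ lapEigenvalue G (k - 1) ∧
    Matrix.mulVec (laplacian G) w.ofLp = μ • w.ofLp}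

/-- Prepend a zero, in the coordinate `none`, to a vector. -/
noncomputable def prependZero {ι : Type*} (w : EuclideanSpace ℝ ι) : EuclideanSpace ℝ (Option ι) :=
  WithLp.toLp 2 (fun o => o.elim 0 (fun i => w i))

/-- The extended spectral feature map built from eigenvectors `v` of the threshold graph of `X`:
prepend zeros to the `v i`, project onto the bottom-`k` eigenspace of the threshold graph of
`X ∪ {x}`, and read off the coordinates at the new vertex. -/
noncomputable def spectralFeature {E ι : Type*} [PseudoMetricSpace E] [Fintype ι] (T : ℝ)
    (X : ι → E) {k : ℕ} (v : Fin k → EuclideanSpace ℝ ι) (x : E) : EuclideanSpace ℝ (Fin k) :=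
  WithLp.toLp 2 (fun i =>
    ((bottomEigenspace (thresholdGraph T (augment X x)) k).starProjection (prependZero (v i))) none)

/-- `f` is `(ε, δ, γ)`-robust for the distribution `D`: the probability that a perturbation of size
at most `ε` changes the value of `f` by more than `δ` is at most `γ`. -/
def IsRobust {E F : Type*} [PseudoMetricSpace E] [MeasurableSpace E] [PseudoMetricSpace F]
    (D : Measure E) (ε δ γ : ℝ) (f : E → F) : Prop :=
  D {x | ∃ x', dist x x' ≤ ε ∧ δ < dist (f x) (f x')} ≤ ENNReal.ofReal γ

/-- The uniform distribution on the sphere of radius `r` about the origin in `ℝ^d`: the normalized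
surface measure of the unit sphere, scaled by `r`. -/
noncomputable def sphereUniform (d : ℕ) (r : ℝ) : Measure (EuclideanSpace ℝ (Fin d)) :=
  Measure.map (fun y : Metric.sphere (0 : EuclideanSpace ℝ (Fin d)) 1 => r • (y : _))
    (((volume : Measure (EuclideanSpace ℝ (Fin d))).toSphere Set.univ)⁻¹ •
      (volume : Measure (EuclideanSpace ℝ (Fin d))).toSphere)

/-- The concentric spheres distribution: radius `1` or `R` with probability `1/2` each, uniform on
the chosen sphere. -/
noncomputable def concentricSpheres (d : ℕ) (R : ℝ) : Measure (EuclideanSpace ℝ (Fin d)) :=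
  (2⁻¹ : ENNReal) • sphereUniform d 1 + (2⁻¹ : ENNReal) • sphereUniform d R

/-- The law of the training set: `N` points from the unit sphere (indices `Sum.inl i`) and `N` from
the sphere of radius `R` (indices `Sum.inr i`), all independent and uniform. -/
noncomputable def trainingLaw (d N : ℕ) (R : ℝ) :
    Measure (Fin N ⊕ Fin N → EuclideanSpace ℝ (Fin d)) :=
  Measure.pi (Sum.elim (fun _ => sphereUniform d 1) (fun _ => sphereUniform d R))

/-! In high dimension independent points on the two spheres are nearly orthogonal, `|⟨x, y⟩| ≤
t‖x‖‖y‖` with a small fixed `t`. Two inner points are then within `√2 + ε`, and a pair with an outer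
point is further apart than `√2 + 3ε`; `T` lies between with slack `ε` on both sides. So `G(X)` is a
clique on the inner points plus `N` isolated vertices, its kernel has dimension `N + 1`, and the
`v_i` form a basis of it.

For `x'` within `ε` of a typical `x`, the new vertex joins the whole clique or is isolated. Either
way `G(x')` has at least `N + 1` components, so the bottom eigenspace is the full kernel and
`P_{x'}` averages over components. An isolated vertex reads off `0`; a joined one reads off
`N/(N+1)` times the clique value of each `v_i`, not all zero because the `v_i` span the kernel
(`spectralFeature_of_isolated`, `spectralFeature_of_joined`).

The probabilities come from the cap bound `sphereUniform_inner_tail` and union bounds over points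
and pairs. -/

/-! ### Laplacian kernel and vanishing eigenvalues -/

section Laplacian

variable {V : Type*} [Fintype V] {G : SimpleGraph V}

theorem laplacian_mulVec_eq_zero_iff {x : V → ℝ} :
    (laplacian G).mulVec x = 0 ↔ ∀ i j, G.Adj i j → x i = x j := by
  classical
  rw [← SimpleGraph.lapMatrix_mulVec_eq_zero_iff_forall_adj]
  unfold laplacian
  convert Iff.rfl

theorem laplacian_posSemidef (G : SimpleGraph V) : (laplacian G).PosSemidef := by
  classical
  exact SimpleGraph.posSemidef_lapMatrix ℝ G

theorem lapEigenvalue_nonneg (G : SimpleGraph V) (j : ℕ) : 0 ≤ lapEigenvalue G j := by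
  classical
  unfold lapEigenvalue
  split_ifs with h
  · have := (laplacian_posSemidef G).eigenvalues_nonneg
      (Fintype.equivOfCardEq (Fintype.card_fin _) (Fin.rev ⟨j, h⟩))
    simpa [Matrix.IsHermitian.eigenvalues] using this
  · exact le_rfl

/-- If the vertices are mapped onto `W` so that adjacent vertices have the same image, then the
Laplacian kernel has dimension at least `|W|`. -/
theorem card_le_finrank_eigenspace_laplacian {W : Type*} [Fintype W] [DecidableEq V] (π : V → W)
    (hπ : Function.Surjective π) (hG : ∀ i j, G.Adj i j → π i = π j) :
    Fintype.card W ≤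
      Module.finrank ℝ (Module.End.eigenspace (Matrix.toEuclideanLin (laplacian G)) 0) := by
  let φ : (W → ℝ) →ₗ[ℝ] EuclideanSpace ℝ V :=
    (WithLp.linearEquiv 2 ℝ (V → ℝ)).symm.toLinearMap ∘ₗ LinearMap.funLeft ℝ ℝ π
  have hφ : ∀ g, φ g ∈ Module.End.eigenspace (Matrix.toEuclideanLin (laplacian G)) 0 := by
    intro g
    rw [Module.End.mem_eigenspace_iff, zero_smul, Matrix.toLpLin_apply, WithLp.toLp_eq_zero,
      laplacian_mulVec_eq_zero_iff]
    intro i j hij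
    change g (π i) = g (π j)
    rw [hG i j hij]
  have hinj : Function.Injective (φ.codRestrict _ hφ) := by
    intro g g' h
    have h' : φ g = φ g' := congrArg Subtype.val h
    funext w
    obtain ⟨i, rfl⟩ := hπ w
    exact congrArg (fun u : EuclideanSpace ℝ V => u i) h'
  simpa using LinearMap.finrank_le_finrank_of_injective hinj

theorem lapEigenvalue_eq_zero {W : Type*} [Fintype W] (π : V → W)
    (hπ : Function.Surjective π) (hG : ∀ i j, G.Adj i j → π i = π j) {j : ℕ}
    (hj : j < Fintype.card W) : lapEigenvalue G j = 0 := by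
  classical
  by_contra hne
  have hpos := lt_of_le_of_ne (lapEigenvalue_nonneg G j) (Ne.symm hne)
  have hV : j < Fintype.card V := hj.trans_le (Fintype.card_le_of_surjective π hπ)
  rw [lapEigenvalue, dif_pos hV] at hpos
  have hcard := LinearMap.IsSymmetric.card_filter_eigenvalues_eq
    (Matrix.isSymmetric_toEuclideanLin_iff.mpr (laplacian_isHermitian G))
    (finrank_euclideanSpace (𝕜 := ℝ) (ι := V)) (0 : ℝ)
  have hle := card_le_finrank_eigenspace_laplacian π hπ hG
  rw [show Module.finrank ℝ (Module.End.eigenspace (Matrix.toEuclideanLin (laplacian G)) 0) = _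
    from hcard.symm] at hle
  -- `eigenvalues₀` is decreasing, so if the eigenvalue at `rev j` were positive, all zeros would
  -- sit strictly after it, in only `j < |W|` places.
  have hsub : (Finset.univ.filter fun i => ((LinearMap.IsSymmetric.eigenvalues
      (Matrix.isSymmetric_toEuclideanLin_iff.mpr (laplacian_isHermitian G))
      (finrank_euclideanSpace (𝕜 := ℝ) (ι := V)) i : ℝ)) = 0) ⊆
      Finset.Ioi (Fin.rev ⟨j, hV⟩) := by
    intro i hi
    rw [Finset.mem_Ioi]
    by_contra hlt
    have := (laplacian_isHermitian G).eigenvalues₀_antitone (not_lt.mp hlt)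
    have hi0 : (laplacian_isHermitian G).eigenvalues₀ i = 0 := (Finset.mem_filter.mp hi).2
    linarith
  have := Finset.card_le_card hsub
  rw [Fin.card_Ioi, Fin.val_rev] at this
  have h2 := hle.trans this
  simp only at h2
  omega

/-- When the `k`-th smallest eigenvalue vanishes, the bottom-`k` eigenspace is the kernel. -/
theorem mem_bottomEigenspace_iff {k : ℕ} (h0 : lapEigenvalue G (k - 1) = 0)
    {w : EuclideanSpace ℝ V} :
    w ∈ bottomEigenspace G k ↔ ∀ i j, G.Adj i j → w i = w j := by
  classical
  rw [← laplacian_mulVec_eq_zero_iff (x := w.ofLp)]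
  constructor
  · intro hw
    induction hw using Submodule.span_induction with
    | mem w hw =>
      obtain ⟨μ, hμ, hw⟩ := hw
      rw [h0] at hμ
      have hnn := (laplacian_posSemidef G).dotProduct_mulVec_nonneg w.ofLp
      rw [hw, star_trivial, dotProduct_smul, smul_eq_mul] at hnn
      have hww : 0 ≤ w.ofLp ⬝ᵥ w.ofLp := Finset.sum_nonneg fun i _ => mul_self_nonneg _
      -- The zero vector solves the equation for every negative `μ`, so it is split off.
      rcases hww.eq_or_lt with hz | hz
      · rw [dotProduct_self_eq_zero.mp hz.symm, Matrix.mulVec_zero]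
      · have : μ = 0 := le_antisymm hμ (nonneg_of_mul_nonneg_left hnn hz)
        rw [hw, this, zero_smul]
    | zero => simp
    | add u v _ _ hu hv => rw [WithLp.ofLp_add, Matrix.mulVec_add, hu, hv, add_zero]
    | smul c u _ hu => rw [WithLp.ofLp_smul, Matrix.mulVec_smul, hu, smul_zero]
  · intro hw
    exact Submodule.subset_span ⟨0, h0.ge, by rw [hw, zero_smul]⟩

end Laplacian

/-! ### The feature map over a separated sample -/

section Feature

variable {N : ℕ} {E : Type*} [PseudoMetricSpace E] {T : ℝ} {X : Fin N ⊕ Fin N → E} {x : E}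

/-- The class of a training index: the indices on the left form one class, those on the right are
singletons. -/
def trainingClass (N : ℕ) : Fin N ⊕ Fin N → Option (Fin N) :=
  Sum.elim (fun _ => none) some

/-- The class of an index of the augmented set: the new point is put with the indices on the
left. -/
def augmentedClass (N : ℕ) : Option (Fin N ⊕ Fin N) → Option (Fin N) :=
  fun o => o.elim none (trainingClass N)

theorem trainingClass_surjective (hN : 1 ≤ N) : Function.Surjective (trainingClass N) := by
  rintro (_ | j)
  · exact ⟨Sum.inl ⟨0, hN⟩, rfl⟩
  · exact ⟨Sum.inr j, rfl⟩

theorem augmentedClass_surjective : Function.Surjective (augmentedClass N) := by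
  rintro (_ | j)
  · exact ⟨none, rfl⟩
  · exact ⟨some (Sum.inr j), rfl⟩

/-- The first `N` points are at mutual distance at most `T`, all other pairs of distinct points are
further apart. -/
structure IsSeparatedSample (T : ℝ) (X : Fin N ⊕ Fin N → E) : Prop where
  dist_le : ∀ i j : Fin N, i ≠ j → dist (X (Sum.inl i)) (X (Sum.inl j)) ≤ T
  lt_dist : ∀ (i : Fin N) (p : Fin N ⊕ Fin N), Sum.inr i ≠ p → T < dist (X (Sum.inr i)) (X p)

theorem IsSeparatedSample.adj_inl (hX : IsSeparatedSample T X) {i j : Fin N} (hij : i ≠ j) :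
    (thresholdGraph T X).Adj (Sum.inl i) (Sum.inl j) :=
  ⟨by simpa using hij, hX.dist_le i j hij⟩

theorem IsSeparatedSample.exists_inl_of_adj (hX : IsSeparatedSample T X) {p q : Fin N ⊕ Fin N}
    (h : (thresholdGraph T X).Adj p q) :
    (∃ i, p = Sum.inl i) ∧ ∃ j, q = Sum.inl j := by
  obtain ⟨hne, hd⟩ := h
  rcases p with i | i
  · rcases q with j | j
    · exact ⟨⟨i, rfl⟩, j, rfl⟩
    · exact absurd hd (not_le.mpr (by rw [dist_comm]; exact hX.lt_dist j _ hne.symm))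
  · exact absurd hd (not_le.mpr (hX.lt_dist i q hne))

theorem IsSeparatedSample.trainingClass_eq (hX : IsSeparatedSample T X) {p q : Fin N ⊕ Fin N}
    (h : (thresholdGraph T X).Adj p q) : trainingClass N p = trainingClass N q := by
  obtain ⟨⟨i, rfl⟩, j, rfl⟩ := hX.exists_inl_of_adj h
  rfl

theorem thresholdGraph_augment_some_some {p q : Fin N ⊕ Fin N} :
    (thresholdGraph T (augment X x)).Adj (some p) (some q) ↔ (thresholdGraph T X).Adj p q := by
  simp [thresholdGraph, augment]

theorem thresholdGraph_augment_none_some {p : Fin N ⊕ Fin N} :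
    (thresholdGraph T (augment X x)).Adj none (some p) ↔ dist x (X p) ≤ T := by
  simp [thresholdGraph, augment]

variable {v : Fin (N + 1) → EuclideanSpace ℝ (Fin N ⊕ Fin N)}

theorem IsSeparatedSample.eigenvector_inl_eq (hN : 1 ≤ N) (hX : IsSeparatedSample T X)
    (hv : IsBottomEigenvectors (thresholdGraph T X) v) (k : Fin (N + 1)) (i j : Fin N) :
    v k (Sum.inl i) = v k (Sum.inl j) := by
  have h0 : lapEigenvalue (thresholdGraph T X) k = 0 :=
    lapEigenvalue_eq_zero (trainingClass N) (trainingClass_surjective hN)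
      (fun _ _ => hX.trainingClass_eq) (by simpa using k.2)
  have h := hv.2 k
  rw [h0, zero_smul, laplacian_mulVec_eq_zero_iff] at h
  by_cases hij : i = j
  · rw [hij]
  · exact h _ _ (hX.adj_inl hij)

/-- Otherwise restriction to the outer indices would embed `N + 1` independent vectors in `ℝ^N`. -/
theorem IsSeparatedSample.exists_eigenvector_inl_ne_zero (hN : 1 ≤ N)
    (hX : IsSeparatedSample T X) (hv : IsBottomEigenvectors (thresholdGraph T X) v) :
    ∃ k, v k (Sum.inl ⟨0, hN⟩) ≠ 0 := by
  by_contra! hz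
  have hli := hv.1.linearIndependent
  let φ : EuclideanSpace ℝ (Fin N ⊕ Fin N) →ₗ[ℝ] (Fin N → ℝ) :=
    LinearMap.funLeft ℝ ℝ Sum.inr ∘ₗ (WithLp.linearEquiv 2 ℝ (Fin N ⊕ Fin N → ℝ)).toLinearMap
  have hφ : LinearIndependent ℝ (φ ∘ v) := by
    refine hli.map_injOn φ ?_
    have hspan : ∀ w ∈ Submodule.span ℝ (Set.range v), ∀ i, w (Sum.inl i) = 0 := by
      intro w hw
      induction hw using Submodule.span_induction with
      | mem w hw =>
        obtain ⟨k, rfl⟩ := hw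
        intro i
        rw [hX.eigenvector_inl_eq hN hv k i ⟨0, hN⟩, hz k]
      | zero => simp
      | add u v _ _ hu hv => intro i; simp [hu i, hv i]
      | smul c u _ hu => intro i; simp [hu i]
    intro w hw w' hw' heq
    ext p
    rcases p with i | i
    · rw [hspan w hw i, hspan w' hw' i]
    · exact congrFun heq i
  have := hφ.fintype_card_le_finrank
  simp at this

/-- Only a lower bound on the kernel dimension is needed, so one class map serves both cases: an
isolated new point may be lumped with the clique. -/
theorem lapEigenvalue_augment_eq_zero
    (h : ∀ p q, (thresholdGraph T (augment X x)).Adj p q →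
      augmentedClass N p = augmentedClass N q) :
    lapEigenvalue (thresholdGraph T (augment X x)) (N + 1 - 1) = 0 :=
  lapEigenvalue_eq_zero (augmentedClass N) augmentedClass_surjective h (by simp)

/-- The padded eigenvector is already constant on components, so the projection fixes it. -/
theorem spectralFeature_of_isolated (hN : 1 ≤ N) (hX : IsSeparatedSample T X)
    (hv : IsBottomEigenvectors (thresholdGraph T X) v) (hx : ∀ p, T < dist x (X p)) :
    spectralFeature T X v x = 0 := by
  have hadj : ∀ p q, (thresholdGraph T (augment X x)).Adj p q →
      ∃ i j, p = some (Sum.inl i) ∧ q = some (Sum.inl j) := by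
    rintro (_ | p) (_ | q) h
    · exact absurd rfl h.1
    · exact absurd (thresholdGraph_augment_none_some.mp h) (not_le.mpr (hx q))
    · exact absurd (thresholdGraph_augment_none_some.mp h.symm) (not_le.mpr (hx p))
    · obtain ⟨⟨i, rfl⟩, j, rfl⟩ := hX.exists_inl_of_adj (thresholdGraph_augment_some_some.mp h)
      exact ⟨i, j, rfl, rfl⟩
  have h0 := lapEigenvalue_augment_eq_zero (N := N) (T := T) (X := X) (x := x) (by
    intro p q h
    obtain ⟨i, j, rfl, rfl⟩ := hadj p q h
    rfl)
  ext k
  have hmem : prependZero (v k) ∈ bottomEigenspace (thresholdGraph T (augment X x)) (N + 1) := by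
    rw [mem_bottomEigenspace_iff h0]
    intro p q h
    obtain ⟨i, j, rfl, rfl⟩ := hadj p q h
    exact hX.eigenvector_inl_eq hN hv k i j
  change ((bottomEigenspace (thresholdGraph T (augment X x)) (N + 1)).starProjection
    (prependZero (v k))) none = 0
  rw [Submodule.starProjection_eq_self_iff.mpr hmem]
  rfl

theorem spectralFeature_of_joined (hN : 1 ≤ N) (hX : IsSeparatedSample T X)
    (hv : IsBottomEigenvectors (thresholdGraph T X) v)
    (hin : ∀ i, dist x (X (Sum.inl i)) ≤ T) (hout : ∀ i, T < dist x (X (Sum.inr i))) :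
    spectralFeature T X v x =
      WithLp.toLp 2 (fun k => (N / (N + 1) : ℝ) * v k (Sum.inl ⟨0, hN⟩)) := by
  have hadj : ∀ p q, (thresholdGraph T (augment X x)).Adj p q →
      augmentedClass N p = none ∧ augmentedClass N q = none := by
    have key : ∀ q, (thresholdGraph T (augment X x)).Adj none (some q) →
        trainingClass N q = none := by
      rintro (i | i) h
      · rfl
      · exact absurd (thresholdGraph_augment_none_some.mp h) (not_le.mpr (hout i))
    rintro (_ | p) (_ | q) h
    · exact absurd rfl h.1
    · exact ⟨rfl, key q h⟩
    · exact ⟨key p h.symm, rfl⟩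
    · obtain ⟨⟨i, rfl⟩, j, rfl⟩ := hX.exists_inl_of_adj (thresholdGraph_augment_some_some.mp h)
      exact ⟨rfl, rfl⟩
  have h0 := lapEigenvalue_augment_eq_zero (N := N) (T := T) (X := X) (x := x)
    (fun p q h => (hadj p q h).1.trans (hadj p q h).2.symm)
  ext k
  set s := v k (Sum.inl ⟨0, hN⟩) with hs
  have hvs : ∀ i, v k (Sum.inl i) = s := fun i => hX.eigenvector_inl_eq hN hv k i _
  -- The projection: `N` clique values `s` and one `0` average to `N s / (N + 1)`.
  let u : EuclideanSpace ℝ (Option (Fin N ⊕ Fin N)) :=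
    WithLp.toLp 2 fun o => (augmentedClass N o).elim ((N / (N + 1) : ℝ) * s)
      (fun j => v k (Sum.inr j))
  change ((bottomEigenspace (thresholdGraph T (augment X x)) (N + 1)).starProjection
    (prependZero (v k))) none = (N / (N + 1) : ℝ) * s
  rw [Submodule.eq_starProjection_of_mem_of_inner_eq_zero (v := u)]
  · rfl
  · rw [mem_bottomEigenspace_iff h0]
    intro p q h
    obtain ⟨hp, hq⟩ := hadj p q h
    simp only [u, hp, hq]
  · intro w hw
    rw [mem_bottomEigenspace_iff h0] at hw
    have hwi : ∀ i, w (some (Sum.inl i)) = w none := fun i =>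
      (hw _ _ (thresholdGraph_augment_none_some.mpr (hin i))).symm
    have hN1 : (N + 1 : ℝ) ≠ 0 := by positivity
    rw [PiLp.inner_apply, Fintype.sum_option, Fintype.sum_sum_type]
    simp only [u, prependZero, augmentedClass, trainingClass, PiLp.sub_apply, Option.elim_none,
      Option.elim_some, Sum.elim_inl, Sum.elim_inr, sub_self, hwi, hvs, mul_zero,
      Finset.sum_const_zero, Finset.sum_const, Finset.card_univ, Fintype.card_fin, nsmul_eq_mul,
      RCLike.inner_apply, conj_trivial]
    field_simp
    ring

end Feature

/-! ### Concentration on the sphere -/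

section Sphere

variable {d : ℕ}

theorem toSphere_univ_ne_zero (hd : 1 ≤ d) :
    (volume : Measure (EuclideanSpace ℝ (Fin d))).toSphere Set.univ ≠ 0 := by
  rw [Measure.toSphere_apply_univ, finrank_euclideanSpace_fin]
  exact mul_ne_zero (by exact_mod_cast (by omega : d ≠ 0))
    (Metric.measure_ball_pos _ _ one_pos).ne'

theorem measurable_smul_sphere (r : ℝ) :
    Measurable (fun y : Metric.sphere (0 : EuclideanSpace ℝ (Fin d)) 1 =>
      r • (y : EuclideanSpace ℝ (Fin d))) :=
  measurable_subtype_coe.const_smul r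

theorem isProbabilityMeasure_sphereUniform (hd : 1 ≤ d) (r : ℝ) :
    IsProbabilityMeasure (sphereUniform d r) := by
  refine ⟨?_⟩
  rw [sphereUniform, Measure.map_apply (measurable_smul_sphere r) MeasurableSet.univ,
    Set.preimage_univ, Measure.smul_apply, smul_eq_mul]
  exact ENNReal.inv_mul_cancel (toSphere_univ_ne_zero hd) (measure_ne_top _ _)

theorem ae_norm_eq_sphereUniform {r : ℝ} (hr : 0 ≤ r) :
    ∀ᵐ x ∂sphereUniform d r, ‖x‖ = r := by
  rw [sphereUniform, ae_map_iff (measurable_smul_sphere r).aemeasurable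
    (measurableSet_eq_fun measurable_norm measurable_const)]
  refine Filter.Eventually.of_forall fun y => ?_
  rw [norm_smul, norm_eq_of_mem_sphere, mul_one, Real.norm_of_nonneg hr]

/-- The squared distance is at most `s² - 2st² + t²`, convex in `s`; the endpoint `s = 0` needs `t²
≤ 1/2`, and `s = 1` gives `1 - t²`. -/
theorem mem_closedBall_of_le_inner {F : Type*} [NormedAddCommGroup F] [InnerProductSpace ℝ F]
    {t s : ℝ} (ht : 0 ≤ t) (ht2 : t ^ 2 ≤ 1 / 2) (hs0 : 0 ≤ s) (hs1 : s ≤ 1) {e y : F}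
    (he : ‖e‖ = 1) (hy : ‖y‖ = 1) (h : t ≤ inner ℝ y e) :
    s • y ∈ Metric.closedBall (t • e) (Real.sqrt (1 - t ^ 2)) := by
  rw [mem_closedBall_iff_norm]
  apply Real.le_sqrt_of_sq_le
  rw [norm_sub_sq_real, norm_smul, norm_smul, he, hy, real_inner_smul_left, real_inner_smul_right,
    Real.norm_of_nonneg hs0, Real.norm_of_nonneg ht]
  have := mul_le_mul_of_nonneg_left h (mul_nonneg hs0 ht)
  nlinarith [mul_nonneg hs0 (sub_nonneg.mpr hs1), mul_nonneg (sub_nonneg.mpr hs1) (sub_nonneg.mpr ht2)]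

open scoped Pointwise in
/-- Concentration of measure on the sphere: spherical caps bounded away from the equator have
exponentially small measure in the dimension. -/
theorem sphereUniform_inner_tail {r t : ℝ} (hr : 0 < r) (ht : 0 ≤ t)
    (ht2 : t ^ 2 ≤ 1 / 2) (u : EuclideanSpace ℝ (Fin d)) :
    sphereUniform d r {x | t * ‖x‖ * ‖u‖ < |inner ℝ x u|} ≤
      ENNReal.ofReal (2 * Real.exp (-(t ^ 2 / 2 * d))) := by
  rcases eq_or_ne u 0 with rfl | hu
  · simp
  set e := (‖u‖)⁻¹ • u with he
  have hu0 : 0 < ‖u‖ := norm_pos_iff.mpr hu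
  have hen : ‖e‖ = 1 := by rw [he, norm_smul, norm_inv, norm_norm, inv_mul_cancel₀ hu0.ne']
  have hue : u = ‖u‖ • e := by rw [he, smul_smul, mul_inv_cancel₀ hu0.ne', one_smul]
  have hmeas : MeasurableSet {x : EuclideanSpace ℝ (Fin d) | t * ‖x‖ * ‖u‖ < |inner ℝ x u|} :=
    (isOpen_lt (by fun_prop) (by fun_prop)).measurableSet
  set ρ := Real.sqrt (1 - t ^ 2) with hρ
  set S := (fun y : Metric.sphere (0 : EuclideanSpace ℝ (Fin d)) 1 =>
      r • (y : EuclideanSpace ℝ (Fin d))) ⁻¹' {x | t * ‖x‖ * ‖u‖ < |inner ℝ x u|} with hS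
  -- `toSphere` measures a set by `d` times the volume of the cone over it; the cones over the two
  -- opposite caps fit in two balls of radius `ρ < 1` when `t > 0`.
  have hcone : Set.Ioo (0 : ℝ) 1 • ((↑) '' S : Set (EuclideanSpace ℝ (Fin d))) ⊆
      Metric.closedBall (t • e) ρ ∪ Metric.closedBall (t • -e) ρ := by
    rintro _ ⟨s, hs, _, ⟨y, hy, rfl⟩, rfl⟩
    have hyn : ‖(y : EuclideanSpace ℝ (Fin d))‖ = 1 := norm_eq_of_mem_sphere y
    have hye : t < |inner ℝ (y : EuclideanSpace ℝ (Fin d)) e| := by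
      have h : t * ‖r • (y : EuclideanSpace ℝ (Fin d))‖ * ‖u‖ <
        |inner ℝ (r • (y : EuclideanSpace ℝ (Fin d))) u| := hy
      rw [norm_smul, hyn, Real.norm_of_nonneg hr.le, real_inner_smul_left, hue,
        real_inner_smul_right, norm_smul, hen, norm_norm, abs_mul, abs_mul, abs_of_pos hr,
        abs_of_pos hu0] at h
      have hpos : 0 < r * ‖u‖ := by positivity
      nlinarith
    rcases lt_abs.mp hye with h | h
    · exact Or.inl (mem_closedBall_of_le_inner ht ht2 hs.1.le hs.2.le hen hyn h.le)
    · refine Or.inr (mem_closedBall_of_le_inner ht ht2 hs.1.le hs.2.le (by rwa [norm_neg]) hyn ?_)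
      rw [inner_neg_right]
      exact h.le
  have hball : ∀ z : EuclideanSpace ℝ (Fin d), volume (Metric.closedBall z ρ) ≤
      ENNReal.ofReal (Real.exp (-(t ^ 2 / 2 * d))) *
        volume (Metric.ball (0 : EuclideanSpace ℝ (Fin d)) 1) := by
    intro z
    rw [Measure.addHaar_closedBall _ _ (Real.sqrt_nonneg _), finrank_euclideanSpace_fin]
    gcongr
    have h1 : ρ ≤ Real.exp (-(t ^ 2 / 2)) := by
      apply Real.sqrt_le_iff.mpr ⟨(Real.exp_pos _).le, ?_⟩
      rw [← Real.exp_nat_mul]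
      have := Real.add_one_le_exp (-t ^ 2)
      rw [show ((2 : ℕ) : ℝ) * -(t ^ 2 / 2) = -t ^ 2 by push_cast; ring]
      linarith
    calc ρ ^ d ≤ Real.exp (-(t ^ 2 / 2)) ^ d := by gcongr
      _ = _ := by rw [← Real.exp_nat_mul]; ring_nf
  rw [sphereUniform, Measure.map_apply (measurable_smul_sphere r) hmeas, Measure.smul_apply,
    smul_eq_mul, ← ENNReal.div_eq_inv_mul]
  refine ENNReal.div_le_of_le_mul ?_
  rw [Measure.toSphere_apply' _ (measurable_smul_sphere r hmeas), Measure.toSphere_apply_univ]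
  calc _ ≤ (Module.finrank ℝ (EuclideanSpace ℝ (Fin d)) : ENNReal) *
        (ENNReal.ofReal (Real.exp (-(t ^ 2 / 2 * d))) *
          volume (Metric.ball (0 : EuclideanSpace ℝ (Fin d)) 1) +
        ENNReal.ofReal (Real.exp (-(t ^ 2 / 2 * d))) *
          volume (Metric.ball (0 : EuclideanSpace ℝ (Fin d)) 1)) := by
        gcongr
        exact (measure_mono hcone).trans
          ((measure_union_le _ _).trans (add_le_add (hball _) (hball _)))
    _ = _ := by
        rw [ENNReal.ofReal_mul zero_le_two, ENNReal.ofReal_ofNat]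
        ring

end Sphere

/-- Independence and Fubini: fix coordinate `j` and bound each slice. -/
theorem pi_measure_pair_le {ι E : Type*} [Fintype ι] [MeasurableSpace E] (μ : ι → Measure E)
    [∀ i, IsProbabilityMeasure (μ i)] {i j : ι} (hij : i ≠ j) {S : Set (E × E)}
    (hS : MeasurableSet S) {C : ENNReal} (h : ∀ y, μ i {x | (x, y) ∈ S} ≤ C) :
    Measure.pi μ {X | (X i, X j) ∈ S} ≤ C := by
  have hind : ProbabilityTheory.IndepFun (fun X : ι → E => X i) (fun X => X j) (Measure.pi μ) :=
    (ProbabilityTheory.iIndepFun_pi (X := fun _ => id) (fun _ => aemeasurable_id)).indepFun hij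
  have hmap := (ProbabilityTheory.indepFun_iff_map_prod_eq_prod_map_map
    (measurable_pi_apply i).aemeasurable (measurable_pi_apply j).aemeasurable).mp hind
  have hi : (Measure.pi μ).map (fun X => X i) = μ i := (measurePreserving_eval μ i).map_eq
  have hj : (Measure.pi μ).map (fun X => X j) = μ j := (measurePreserving_eval μ j).map_eq
  rw [hi, hj] at hmap
  have hpre : {X : ι → E | (X i, X j) ∈ S} = (fun X => (X i, X j)) ⁻¹' S := rfl
  rw [hpre, ← Measure.map_apply (by fun_prop) hS, hmap, Measure.prod_apply_symm hS]
  calc ∫⁻ y, μ i ((fun x => (x, y)) ⁻¹' S) ∂μ j ≤ ∫⁻ _, C ∂μ j := lintegral_mono h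
    _ = C := by simp

/-! ### Distances between nearly orthogonal points -/

section Geometry

variable {F : Type*} [NormedAddCommGroup F] [InnerProductSpace ℝ F] {ε t R : ℝ} {x y : F}

theorem dist_le_of_abs_inner_le (hε : 0 < ε) (htε : t ≤ ε) (hx : ‖x‖ = 1) (hy : ‖y‖ = 1)
    (h : |inner ℝ x y| ≤ t * ‖x‖ * ‖y‖) : dist x y ≤ Real.sqrt 2 + ε := by
  rw [hx, hy, mul_one, mul_one] at h
  have hs := Real.sq_sqrt (zero_le_two (α := ℝ))
  have hs1 : 1 ≤ Real.sqrt 2 := Real.one_le_sqrt.mpr one_le_two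
  rw [dist_eq_norm]
  refine le_of_sq_le_sq ?_ (by positivity)
  rw [norm_sub_sq_real, hx, hy]
  nlinarith [neg_abs_le (inner ℝ x y)]

/-- The target squared is at most `2 + 9ε + 9ε²`. The squared distance is at least `2 + 14ε + 48ε²`
for a mixed pair and, using `t ≤ 1/2`, at least `2 + 14ε + 64ε²` for two outer points. -/
theorem lt_dist_of_abs_inner_le (hε : 0 < ε) (ht : 0 ≤ t) (htε : t ≤ ε) (ht1 : t ≤ 1 / 2)
    (hR : R = 1 + 8 * ε) (hx : ‖x‖ = R) (hy : ‖y‖ = 1 ∨ ‖y‖ = R)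
    (h : |inner ℝ x y| ≤ t * ‖x‖ * ‖y‖) : Real.sqrt 2 + 3 * ε < dist x y := by
  have hs := Real.sq_sqrt (zero_le_two (α := ℝ))
  have hs1 : Real.sqrt 2 < 3 / 2 := by
    rw [Real.sqrt_lt' (by norm_num)]
    norm_num
  rw [dist_eq_norm]
  refine lt_of_pow_lt_pow_left₀ 2 (norm_nonneg _) ?_
  rw [norm_sub_sq_real]
  have hin := (le_abs_self _).trans h
  have hsε : Real.sqrt 2 * ε ≤ 3 / 2 * ε := by gcongr
  have hlhs : (Real.sqrt 2 + 3 * ε) ^ 2 ≤ 2 + 9 * ε + 9 * ε ^ 2 := by nlinarith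
  have htε' : t * ε ≤ 1 / 2 * ε := by gcongr
  rcases hy with hy | hy
  · rw [hx, hy, hR] at hin ⊢
    nlinarith [mul_pos hε hε]
  · rw [hx, hy, hR] at hin ⊢
    have : t * ε ^ 2 ≤ 1 / 2 * ε ^ 2 := by gcongr
    nlinarith [mul_pos hε hε]

end Geometry

/-! ### Union bounds -/

section Sample

variable {d N : ℕ} {ε t R T : ℝ} {X : Fin N ⊕ Fin N → EuclideanSpace ℝ (Fin d)}

theorem isSeparatedSample_of_abs_inner_le (hε : 0 < ε) (ht : 0 ≤ t) (htε : t ≤ ε)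
    (ht1 : t ≤ 1 / 2) (hR : R = 1 + 8 * ε) (hT : T = Real.sqrt 2 + 2 * ε)
    (hl : ∀ i, ‖X (Sum.inl i)‖ = 1) (hr : ∀ i, ‖X (Sum.inr i)‖ = R)
    (h : ∀ p q, p ≠ q → |inner ℝ (X p) (X q)| ≤ t * ‖X p‖ * ‖X q‖) : IsSeparatedSample T X where
  dist_le i j hij := by
    have := dist_le_of_abs_inner_le hε htε (hl i) (hl j) (h _ _ (by simpa using hij))
    linarith
  lt_dist i p hip := by
    have := lt_dist_of_abs_inner_le hε ht htε ht1 hR (hr i)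
      (Sum.forall (p := fun p => ‖X p‖ = 1 ∨ ‖X p‖ = R) |>.mpr
        ⟨fun j => Or.inl (hl j), fun j => Or.inr (hr j)⟩ p) (h _ _ hip)
    linarith

/-- Arbitrary `P` is allowed because monotonicity of measure needs no measurability; events about
`spectralFeature` can be used directly. -/
theorem sphereUniform_le_of_imp {r : ℝ} (hr : 0 < r) (ht : 0 ≤ t)
    (ht2 : t ^ 2 ≤ 1 / 2) (hd2 : 8 ≤ Real.exp (t ^ 2 / 4 * d))
    {P : EuclideanSpace ℝ (Fin d) → Prop}
    (hP : ∀ x, ‖x‖ = r → (∀ p, |inner ℝ x (X p)| ≤ t * ‖x‖ * ‖X p‖) → ¬ P x) :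
    sphereUniform d r {x | P x} ≤ ENNReal.ofReal (N * Real.exp (-(t ^ 2 / 4 * d))) := by
  calc sphereUniform d r {x | P x}
      ≤ sphereUniform d r (⋃ p, {x | t * ‖x‖ * ‖X p‖ < |inner ℝ x (X p)|}) := by
        refine measure_mono_ae ?_
        filter_upwards [ae_norm_eq_sphereUniform hr.le] with x hx hPx
        by_contra hnot
        refine hP x hx (fun p => ?_) hPx
        by_contra hlt
        exact hnot (Set.mem_iUnion.mpr ⟨p, not_le.mp hlt⟩)
    _ ≤ ∑ p, sphereUniform d r {x | t * ‖x‖ * ‖X p‖ < |inner ℝ x (X p)|} :=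
        measure_iUnion_fintype_le _ _
    _ ≤ ∑ _p : Fin N ⊕ Fin N, ENNReal.ofReal (2 * Real.exp (-(t ^ 2 / 2 * d))) :=
        Finset.sum_le_sum fun p _ => sphereUniform_inner_tail hr ht ht2 (X p)
    _ = ENNReal.ofReal (2 * N * (2 * Real.exp (-(t ^ 2 / 2 * d)))) := by
        rw [Finset.sum_const, Finset.card_univ, Fintype.card_sum, Fintype.card_fin, nsmul_eq_mul,
          ENNReal.ofReal_mul (by positivity : (0 : ℝ) ≤ 2 * N), ← two_mul, ← ENNReal.ofReal_natCast]
        push_cast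
        rfl
    _ ≤ _ := by
        apply ENNReal.ofReal_le_ofReal
        have hE : Real.exp (-(t ^ 2 / 4 * d)) =
            Real.exp (t ^ 2 / 4 * d) * Real.exp (-(t ^ 2 / 2 * d)) := by
          rw [← Real.exp_add]; ring_nf
        rw [hE]
        have := mul_le_mul_of_nonneg_right hd2 (Real.exp_pos (-(t ^ 2 / 2 * d))).le
        have hN : (0 : ℝ) ≤ N := N.cast_nonneg
        nlinarith [Real.exp_pos (-(t ^ 2 / 2 * d))]

theorem trainingLaw_le_of_imp (hd : 1 ≤ d) (hR : 0 < R) (ht : 0 ≤ t) (ht2 : t ^ 2 ≤ 1 / 2)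
    (hd2 : 8 ≤ Real.exp (t ^ 2 / 4 * d))
    {P : (Fin N ⊕ Fin N → EuclideanSpace ℝ (Fin d)) → Prop}
    (hP : ∀ X, (∀ i, ‖X (Sum.inl i)‖ = 1) → (∀ i, ‖X (Sum.inr i)‖ = R) →
      (∀ p q, p ≠ q → |inner ℝ (X p) (X q)| ≤ t * ‖X p‖ * ‖X q‖) → ¬ P X) :
    trainingLaw d N R {X | P X} ≤
      ENNReal.ofReal ((N : ℝ) ^ 2 * Real.exp (-(t ^ 2 / 4 * d))) := by
  let ρ : Fin N ⊕ Fin N → ℝ := Sum.elim (fun _ => 1) (fun _ => R)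
  have hρ : ∀ p, 0 < ρ p := by rintro (p | p); exacts [one_pos, hR]
  have hlaw : trainingLaw d N R = Measure.pi (fun p => sphereUniform d (ρ p)) := by
    rw [trainingLaw]
    congr 1
    funext p
    rcases p with p | p <;> rfl
  have := fun p => isProbabilityMeasure_sphereUniform hd (ρ p)
  set S : Set (EuclideanSpace ℝ (Fin d) × EuclideanSpace ℝ (Fin d)) :=
    {z | t * ‖z.1‖ * ‖z.2‖ < |inner ℝ z.1 z.2|} with hS
  have hSm : MeasurableSet S := (isOpen_lt (by fun_prop) (by fun_prop)).measurableSet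
  set δ := ENNReal.ofReal (2 * Real.exp (-(t ^ 2 / 2 * d))) with hδ
  rw [hlaw]
  calc Measure.pi (fun p => sphereUniform d (ρ p)) {X | P X}
      ≤ Measure.pi (fun p => sphereUniform d (ρ p))
          (⋃ p, ⋃ q, {X | p ≠ q ∧ (X p, X q) ∈ S}) := by
        refine measure_mono_ae ?_
        have hae : ∀ᵐ X ∂Measure.pi (fun p => sphereUniform d (ρ p)), ∀ p, ‖X p‖ = ρ p :=
          ae_all_iff.mpr fun p => (measurePreserving_eval (fun p => sphereUniform d (ρ p)) p
            ).quasiMeasurePreserving.ae (ae_norm_eq_sphereUniform (hρ p).le)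
        filter_upwards [hae] with X hX hPX
        by_contra hnot
        refine hP X (fun i => hX (Sum.inl i)) (fun i => hX (Sum.inr i)) (fun p q hpq => ?_) hPX
        by_contra hlt
        exact hnot (Set.mem_iUnion₂.mpr ⟨p, q, hpq, not_le.mp hlt⟩)
    _ ≤ ∑ p, ∑ q, Measure.pi (fun p => sphereUniform d (ρ p))
          {X | p ≠ q ∧ (X p, X q) ∈ S} :=
        (measure_iUnion_fintype_le _ _).trans
          (Finset.sum_le_sum fun p _ => measure_iUnion_fintype_le _ _)
    _ ≤ ∑ _p : Fin N ⊕ Fin N, ∑ _q : Fin N ⊕ Fin N, δ := by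
        refine Finset.sum_le_sum fun p _ => Finset.sum_le_sum fun q _ => ?_
        by_cases hpq : p = q
        · simp [hpq]
        · refine (measure_mono fun X hX => hX.2).trans (pi_measure_pair_le _ hpq hSm fun y => ?_)
          exact sphereUniform_inner_tail (hρ p) ht ht2 y
    _ = ENNReal.ofReal ((2 * N) * (2 * N) * (2 * Real.exp (-(t ^ 2 / 2 * d)))) := by
        rw [Finset.sum_const, Finset.sum_const, Finset.card_univ, Fintype.card_sum,
          Fintype.card_fin, smul_smul, nsmul_eq_mul,
          ENNReal.ofReal_mul (by positivity : (0 : ℝ) ≤ 2 * N * (2 * N)), ← two_mul,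
          ← ENNReal.ofReal_natCast]
        push_cast
        rfl
    _ ≤ _ := by
        apply ENNReal.ofReal_le_ofReal
        have hE : Real.exp (-(t ^ 2 / 4 * d)) =
            Real.exp (t ^ 2 / 4 * d) * Real.exp (-(t ^ 2 / 2 * d)) := by
          rw [← Real.exp_add]; ring_nf
        rw [hE]
        -- Half of the exponent absorbs the factor `8`: `(2N)²` pairs, two caps each.
        have h8 := mul_le_mul_of_nonneg_right hd2 (Real.exp_pos (-(t ^ 2 / 2 * d))).le
        calc 2 * N * (2 * N) * (2 * Real.exp (-(t ^ 2 / 2 * d)))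
            = (N : ℝ) ^ 2 * (8 * Real.exp (-(t ^ 2 / 2 * d))) := by ring
          _ ≤ _ := by gcongr

end Sample

/-! ### Choice of constants and conclusion -/

theorem theorem5 (R : ℝ) (hR : 1 < R) (ε : ℝ) (hε : ε = (R - 1) / 8)
    (T : ℝ) (hT : T = Real.sqrt 2 + 2 * ε) :
    ∃ c : ℝ, 0 < c ∧ ∃ d₀ : ℕ, ∀ d : ℕ, d₀ ≤ d → ∀ N : ℕ, 1 ≤ N →
      ∀ γ : ℝ, γ = N * Real.exp (-(c * d)) →
        trainingLaw d N R
          {X | ¬ ∀ v : Fin (N + 1) → EuclideanSpace ℝ (Fin N ⊕ Fin N),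
            IsBottomEigenvectors (thresholdGraph T X) v →
              (∃ a b : EuclideanSpace ℝ (Fin (N + 1)), a ≠ b ∧
                sphereUniform d 1 {x | spectralFeature T X v x ≠ a} ≤ ENNReal.ofReal γ ∧
                sphereUniform d R {x | spectralFeature T X v x ≠ b} ≤ ENNReal.ofReal γ) ∧
              IsRobust (concentricSpheres d R) ε 0 γ (spectralFeature T X v)}
        ≤ ENNReal.ofReal ((N : ℝ) ^ 2 * Real.exp (-(c * d))) := by
  have hε0 : 0 < ε := by linarith
  have hRε : R = 1 + 8 * ε := by linarith
  have hR0 : 0 < R := by linarith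
  obtain ⟨t, ht, htε, ht1⟩ : ∃ t : ℝ, 0 < t ∧ t ≤ ε ∧ t ≤ 1 / 2 :=
    ⟨min ε (1 / 2), lt_min hε0 one_half_pos, min_le_left _ _, min_le_right _ _⟩
  have ht2 : t ^ 2 ≤ 1 / 2 := by nlinarith
  have hc : 0 < t ^ 2 / 4 := by positivity
  refine ⟨t ^ 2 / 4, hc, max 1 ⌈8 / (t ^ 2 / 4)⌉₊, fun d hd N hN γ hγ => ?_⟩
  have hd1 : 1 ≤ d := (le_max_left _ _).trans hd
  have hd2 : 8 ≤ Real.exp (t ^ 2 / 4 * d) := by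
    have h := Nat.ceil_le.mp ((le_max_right _ _).trans hd)
    rw [div_le_iff₀' hc] at h
    linarith [Real.add_one_le_exp (t ^ 2 / 4 * d)]
  refine trainingLaw_le_of_imp hd1 hR0 ht.le ht2 hd2 fun X hl hr hX => not_not.mpr fun v hv => ?_
  have hsep := isSeparatedSample_of_abs_inner_le hε0 ht.le htε ht1 hRε hT hl hr hX
  set a : EuclideanSpace ℝ (Fin (N + 1)) :=
    WithLp.toLp 2 (fun k => (N / (N + 1) : ℝ) * v k (Sum.inl ⟨0, hN⟩)) with ha
  -- Near-orthogonality is asked of `x` alone; every `x'` in its `ε`-ball is then covered by the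
  -- slack around `T`, which gives robustness.
  have hin : ∀ x, ‖x‖ = 1 → (∀ p, |inner ℝ x (X p)| ≤ t * ‖x‖ * ‖X p‖) →
      ∀ x', dist x x' ≤ ε → spectralFeature T X v x' = a := by
    intro x hx hgood x' hxx'
    refine spectralFeature_of_joined hN hsep hv (fun i => ?_) (fun i => ?_)
    · have h1 := dist_le_of_abs_inner_le hε0 htε hx (hl i) (hgood _)
      have h2 := dist_triangle_left x' (X (Sum.inl i)) x
      linarith
    · have hg := hgood (Sum.inr i)
      rw [real_inner_comm, mul_right_comm] at hg
      have h1 := lt_dist_of_abs_inner_le hε0 ht.le htε ht1 hRε (hr i) (Or.inl hx) hg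
      rw [dist_comm] at h1
      have h2 := dist_triangle x x' (X (Sum.inr i))
      linarith
  have hout : ∀ x, ‖x‖ = R → (∀ p, |inner ℝ x (X p)| ≤ t * ‖x‖ * ‖X p‖) →
      ∀ x', dist x x' ≤ ε → spectralFeature T X v x' = 0 := by
    intro x hx hgood x' hxx'
    refine spectralFeature_of_isolated hN hsep hv fun p => ?_
    have h1 := lt_dist_of_abs_inner_le hε0 ht.le htε ht1 hRε hx
      (Sum.forall (p := fun p => ‖X p‖ = 1 ∨ ‖X p‖ = R) |>.mpr
        ⟨fun j => Or.inl (hl j), fun j => Or.inr (hr j)⟩ p) (hgood p)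
    have h2 := dist_triangle x x' (X p)
    linarith
  rw [hγ]
  have hself : ∀ x : EuclideanSpace ℝ (Fin d), dist x x ≤ ε := fun x => by
    rw [dist_self]; exact hε0.le
  refine ⟨⟨a, 0, ?_, ?_, ?_⟩, ?_⟩
  · obtain ⟨k, hk⟩ := hsep.exists_eigenvector_inl_ne_zero hN hv
    intro ha0
    have h0 : (N / (N + 1) : ℝ) * v k (Sum.inl ⟨0, hN⟩) = 0 :=
      congrArg (fun u : EuclideanSpace ℝ (Fin (N + 1)) => u k) ha0
    have hNpos : (0 : ℝ) < N := by exact_mod_cast hN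
    exact (mul_ne_zero (by positivity) hk) h0
  · exact sphereUniform_le_of_imp one_pos ht.le ht2 hd2
      fun x hx hgood => not_not.mpr (hin x hx hgood x (hself x))
  · exact sphereUniform_le_of_imp hR0 ht.le ht2 hd2
      fun x hx hgood => not_not.mpr (hout x hx hgood x (hself x))
  · have h1 := sphereUniform_le_of_imp (N := N) (X := X) one_pos ht.le ht2 hd2
      (P := fun x => ∃ x', dist x x' ≤ ε ∧
        0 < dist (spectralFeature T X v x) (spectralFeature T X v x')) (by
        rintro x hx hgood ⟨x', hxx', hlt⟩
        rw [hin x hx hgood x (hself x), hin x hx hgood x' hxx', dist_self] at hlt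
        exact hlt.false)
    have h2 := sphereUniform_le_of_imp (N := N) (X := X) hR0 ht.le ht2 hd2
      (P := fun x => ∃ x', dist x x' ≤ ε ∧
        0 < dist (spectralFeature T X v x) (spectralFeature T X v x')) (by
        rintro x hx hgood ⟨x', hxx', hlt⟩
        rw [hout x hx hgood x (hself x), hout x hx hgood x' hxx', dist_self] at hlt
        exact hlt.false)
    rw [IsRobust, concentricSpheres, Measure.add_apply, Measure.smul_apply, Measure.smul_apply,
      smul_eq_mul, smul_eq_mul]
    calc _ ≤ (2⁻¹ : ENNReal) * ENNReal.ofReal (N * Real.exp (-(t ^ 2 / 4 * d))) +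
          2⁻¹ * ENNReal.ofReal (N * Real.exp (-(t ^ 2 / 4 * d))) := by gcongr
      _ = _ := by rw [← add_mul, ENNReal.inv_two_add_inv_two, one_mul]
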